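/- Let $K,T>0$. There is a constant $c=c(K,T)>0$, depending only on $K$ and $T$, such that the following holds. Let $G=(V,w,m)$ be a measured weighted graph: $V$ is a countable set, $w:V\times V\to[0,\infty)$ is symmetric and zero on the diagonal, $m:V\to(0,\infty)$, and $G$ is connected and locally finite (each $\{y: w(x,y)>0\}$ is finite). For $f,g:V\to\mathbb R$ put $$\Delta f(x)=\sum_{y\in V}\frac{w(x,y)}{m(x)}\,(f(y)-f(x)),\qquad \Gamma(f,g)=\tfrac12\big(\Delta(fg)-f\Delta g-g\Delta f\big),$$ $$\Gamma_2(f,g)=\tfrac12\big(\Delta\Gamma(f,g)-\Gamma(f,\Delta g)-\Gamma(g,\Delta f)\big),\qquad \Gamma f=\Gamma(f,f),\quad \Gamma_2f=\Gamma_2(f,f),$$ $\|f\|_1=\sum_x m(x)|f(x)|\in[0,\infty]$, $\|f\|_\infty=\sup_x|f(x)|$. Let $P_t=e^{t\Delta}$, $t\ge 0$, be the heat semigroup, $P_tf(x)=\sum_{n\ge0}\frac{t^n}{n!}\Delta^nf(x)$. Let $\rho:V\to\mathbb R$ and suppose that 1. $G$ has bounded degree: $\sup_x\sum_y w(x,y)/m(x)<\infty$;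 2. $CD(\rho,\infty)$ holds: $\Gamma_2 f(x)\ge\rho(x)\,\Gamma f(x)$ for all bounded $f:V\to\mathbb R$ and all $x\in V$; 3. with $r_-=\max\{-r,0\}$ and $k_T(W):=\sup_{n\in\mathbb N}\int_0^T\|P_t(n\wedge W)\|_\infty\,dt$ for $W:V\to[0,\infty)$, $$k_T\big((\rho-K)_-\big)<\tfrac14\big(1-e^{-KT/2}\big).$$ Then for all $f:V\to\mathbb R$ and all $t\ge0$, $$\|f-P_tf\|_1\le c\,\sqrt t\,\big\|\sqrt{\Gamma f}\big\|_1,$$ where the right-hand side is read as $0$ for $t=0$ and may be $+\infty$ for $t>0$. (Under the bounded-degree assumption the series for $P_tf$ converges absolutely at every vertex whenever $f$ is bounded or $\|\sqrt{\Gamma f}\|_1<\infty$; if $\|\sqrt{\Gamma f}\|_1=\infty$ and $t>0$ the inequality is trivially true.) -/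

import Mathlib

open scoped ENNReal Nat

/-- A measured and weighted graph on the vertex set `V`: symmetric edge weights `w ≥ 0` vanishing
on the diagonal and a vertex measure `m > 0`; locally finite and connected. -/
structure MWGraph (V : Type*) where
  w : V → V → ℝ
  m : V → ℝ
  w_nonneg : ∀ x y, 0 ≤ w x y
  w_symm : ∀ x y, w x y = w y x
  w_self : ∀ x, w x x = 0
  m_pos : ∀ x, 0 < m x
  locallyFinite : ∀ x, {y | 0 < w x y}.Finite
  connected : ∀ x y, Relation.ReflTransGen (fun a b => 0 < w a b) x y

namespace MWGraph

variable {V : Type*} (G : MWGraph V)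

/-- The finite set of neighbours of `x`. -/
noncomputable def nbrs (x : V) : Finset V := (G.locallyFinite x).toFinset

/-- `q(x,y) = w(x,y) / m(x)`. -/
noncomputable def q (x y : V) : ℝ := G.w x y / G.m x

/-- The weighted degree `Deg(x) = ∑_y q(x,y)`; all other summands vanish. -/
noncomputable def deg (x : V) : ℝ := ∑ y ∈ G.nbrs x, G.q x y

/-- `sup_x Deg(x) < ∞`. -/
def BoundedDegree : Prop := BddAbove (Set.range G.deg)

/-- The Laplacian `Δ f(x) = ∑_y q(x,y) (f(y) - f(x))`. -/
noncomputable def lap (f : V → ℝ) (x : V) : ℝ := ∑ y ∈ G.nbrs x, G.q x y * (f y - f x)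

/-- The carré du champ operator `Γ(f,g) = (Δ(fg) - f Δg - g Δf) / 2`. -/
noncomputable def Gam (f g : V → ℝ) (x : V) : ℝ :=
  (1 / 2) * (G.lap (f * g) x - f x * G.lap g x - g x * G.lap f x)

/-- `Γ₂(f,g) = (Δ Γ(f,g) - Γ(f,Δg) - Γ(g,Δf)) / 2`. -/
noncomputable def Gam2 (f g : V → ℝ) (x : V) : ℝ :=
  (1 / 2) * (G.lap (G.Gam f g) x - G.Gam f (G.lap g) x - G.Gam g (G.lap f) x)

/-- The variable curvature dimension condition `CD(ρ,n)`, `n ∈ (0,∞]` (with `1/∞ = 0`). -/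
def CD (ρ : V → ℝ) (n : ℝ≥0∞) : Prop :=
  ∀ f : V → ℝ, (∃ C, ∀ x, |f x| ≤ C) →
    ∀ x, ρ x * G.Gam f f x + (n⁻¹).toReal * (G.lap f x) ^ 2 ≤ G.Gam2 f f x

/-- The heat semigroup `P_t f = e^{tΔ} f = ∑_n t^n/n! Δ^n f`, evaluated pointwise.
For graphs of bounded degree `Δ` is a bounded operator on every `ℓ^p(V,m)`, `1 ≤ p ≤ ∞`, so that
the semigroup generated by `Δ` on these spaces is given by this absolutely convergent series
(see `summable_heat_of_bounded` and `summable_heat_of_grad`). -/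
noncomputable def heat (t : ℝ) (f : V → ℝ) (x : V) : ℝ :=
  ∑' n : ℕ, t ^ n / n ! * (G.lap^[n] f) x

/-- The weighted norm `‖f‖₁ = ∑_x m(x) |f(x)|`, with values in `[0,∞]`. -/
noncomputable def norm1 (f : V → ℝ) : ℝ≥0∞ := ∑' x, ENNReal.ofReal (G.m x * |f x|)

/-- The supremum norm, with values in `[0,∞]`. -/
noncomputable def supNorm (f : V → ℝ) : ℝ≥0∞ := ⨆ x, ENNReal.ofReal |f x|

/-- The Kato constant `k_T(W) = sup_n ∫_0^T ‖P_t (n ∧ W)‖_∞ dt`. -/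
noncomputable def kato (T : ℝ) (W : V → ℝ) : ℝ≥0∞ :=
  ⨆ n : ℕ, ∫⁻ t in Set.Ioc 0 T, supNorm (G.heat t (fun x => min (n : ℝ) (W x)))

/-! Convergence of the series defining the heat semigroup. -/

lemma q_nonneg (x y : V) : 0 ≤ G.q x y := div_nonneg (G.w_nonneg x y) (G.m_pos x).le

lemma abs_lap_le (f : V → ℝ) (x : V) :
    |G.lap f x| ≤ ∑ y ∈ G.nbrs x, G.q x y * |f y - f x| := by
  refine (Finset.abs_sum_le_sum_abs _ _).trans_eq (Finset.sum_congr rfl fun y _ => ?_)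
  rw [abs_mul, abs_of_nonneg (G.q_nonneg x y)]

lemma summable_of_pow_bound {a : ℕ → ℝ} {B C : ℝ} (t : ℝ) (h : ∀ n, |a n| ≤ B ^ n * C) :
    Summable fun n : ℕ => t ^ n / n ! * a n := by
  refine Summable.of_norm_bounded
    (((Real.summable_pow_div_factorial (|t| * B)).mul_right C)) fun n => ?_
  rw [Real.norm_eq_abs, abs_mul, abs_div, abs_pow, Nat.abs_cast, mul_pow]
  calc |t| ^ n / n ! * |a n| ≤ |t| ^ n / n ! * (B ^ n * C) := by gcongr; exact h n
    _ = _ := by ring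

lemma summable_heat_of_bounded (hG : G.BoundedDegree) {f : V → ℝ} {C : ℝ}
    (hf : ∀ x, |f x| ≤ C) (t : ℝ) (x : V) :
    Summable fun n : ℕ => t ^ n / n ! * (G.lap^[n] f) x := by
  obtain ⟨D, hD⟩ := hG
  have hD' : ∀ x, G.deg x ≤ D := fun x => hD ⟨x, rfl⟩
  refine summable_of_pow_bound (B := 2 * D) (C := C) t fun n => ?_
  induction n generalizing x with
  | zero => simpa using hf x
  | succ n ih =>
    rw [Function.iterate_succ_apply']
    refine (G.abs_lap_le _ x).trans ?_
    calc ∑ y ∈ G.nbrs x, G.q x y * |(G.lap^[n] f) y - (G.lap^[n] f) x|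
        ≤ ∑ y ∈ G.nbrs x, G.q x y * (2 * ((2 * D) ^ n * C)) := by
          refine Finset.sum_le_sum fun y _ => mul_le_mul_of_nonneg_left ?_ (G.q_nonneg x y)
          have := abs_sub ((G.lap^[n] f) y) ((G.lap^[n] f) x)
          linarith [ih x, ih y]
      _ = G.deg x * (2 * ((2 * D) ^ n * C)) := by rw [deg, Finset.sum_mul]
      _ ≤ D * (2 * ((2 * D) ^ n * C)) := by
          refine mul_le_mul_of_nonneg_right (hD' x) ?_
          linarith [ih x, abs_nonneg ((G.lap^[n] f) x)]
      _ = _ := by ring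

lemma mem_nbrs {x y : V} : y ∈ G.nbrs x ↔ 0 < G.w x y := by simp [nbrs]

lemma Gam_self (f : V → ℝ) (x : V) :
    G.Gam f f x = 1 / 2 * ∑ y ∈ G.nbrs x, G.q x y * (f y - f x) ^ 2 := by
  simp only [Gam, lap, Pi.mul_apply, Finset.mul_sum, ← Finset.sum_sub_distrib]
  exact Finset.sum_congr rfl fun y _ => by ring

lemma abs_lap_le_sqrt_Gam {D : ℝ} (hD : ∀ x, G.deg x ≤ D) (f : V → ℝ) (x : V) :
    |G.lap f x| ≤ Real.sqrt (2 * D) * Real.sqrt (G.Gam f f x) := by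
  have hdeg : 0 ≤ G.deg x := Finset.sum_nonneg fun y _ => G.q_nonneg x y
  have hΓ : 0 ≤ G.Gam f f x := by
    rw [Gam_self]
    exact mul_nonneg (by norm_num)
      (Finset.sum_nonneg fun y _ => mul_nonneg (G.q_nonneg x y) (sq_nonneg _))
  rw [← Real.sqrt_mul (by linarith [hD x])]
  refine Real.abs_le_sqrt ?_
  have h := Finset.sum_sq_le_sum_mul_sum_of_sq_le_mul (G.nbrs x) (f := fun y => G.q x y)
    (g := fun y => G.q x y * (f y - f x) ^ 2) (r := fun y => G.q x y * (f y - f x))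
    (fun y _ => G.q_nonneg x y) (fun y _ => mul_nonneg (G.q_nonneg x y) (sq_nonneg _))
    (fun y _ => le_of_eq (by ring))
  have e : ∑ y ∈ G.nbrs x, G.q x y * (f y - f x) ^ 2 = 2 * G.Gam f f x := by
    rw [Gam_self]; ring
  rw [e] at h
  calc (G.lap f x) ^ 2 ≤ G.deg x * (2 * G.Gam f f x) := h
    _ ≤ D * (2 * G.Gam f f x) := mul_le_mul_of_nonneg_right (hD x) (by linarith)
    _ = _ := by ring

lemma tsum_w_le {D : ℝ} (hD : ∀ x, G.deg x ≤ D) (x : V) :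
    ∑' y, ENNReal.ofReal (G.w x y) ≤ ENNReal.ofReal (D * G.m x) := by
  rw [tsum_eq_sum (s := G.nbrs x), ← ENNReal.ofReal_sum_of_nonneg fun y _ => G.w_nonneg x y]
  · refine ENNReal.ofReal_le_ofReal ?_
    have h : ∑ y ∈ G.nbrs x, G.w x y = G.deg x * G.m x := by
      rw [deg, Finset.sum_mul]
      exact Finset.sum_congr rfl fun y _ => by rw [q, div_mul_cancel₀ _ (G.m_pos x).ne']
    rw [h]
    exact mul_le_mul_of_nonneg_right (hD x) (G.m_pos x).le
  · intro y hy
    rw [mem_nbrs] at hy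
    simpa using not_lt.1 hy

lemma norm1_lap_le {D : ℝ} (hD0 : 0 ≤ D) (hD : ∀ x, G.deg x ≤ D) (g : V → ℝ) :
    G.norm1 (G.lap g) ≤ ENNReal.ofReal (2 * D) * G.norm1 g := by
  have hx : ∀ x, ENNReal.ofReal (G.m x * |G.lap g x|) ≤
      ∑' y, ENNReal.ofReal (G.w x y) * ENNReal.ofReal |g y| +
      ∑' y, ENNReal.ofReal (G.w x y) * ENNReal.ofReal |g x| := by
    intro x
    rw [← ENNReal.tsum_add]
    refine le_trans ?_ (ENNReal.sum_le_tsum (G.nbrs x))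
    have : ∀ y, ENNReal.ofReal (G.w x y) * ENNReal.ofReal |g y| +
        ENNReal.ofReal (G.w x y) * ENNReal.ofReal |g x| =
        ENNReal.ofReal (G.w x y * (|g y| + |g x|)) := fun y => by
      rw [mul_add, ENNReal.ofReal_add (mul_nonneg (G.w_nonneg x y) (abs_nonneg _))
        (mul_nonneg (G.w_nonneg x y) (abs_nonneg _)), ENNReal.ofReal_mul (G.w_nonneg x y),
        ENNReal.ofReal_mul (G.w_nonneg x y)]
    simp only [this]
    rw [← ENNReal.ofReal_sum_of_nonneg fun y _ =>
      mul_nonneg (G.w_nonneg x y) (add_nonneg (abs_nonneg _) (abs_nonneg _))]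
    refine ENNReal.ofReal_le_ofReal
      ((mul_le_mul_of_nonneg_left (G.abs_lap_le g x) (G.m_pos x).le).trans ?_)
    rw [Finset.mul_sum]
    refine Finset.sum_le_sum fun y _ => ?_
    rw [← mul_assoc, q, mul_div_cancel₀ _ (G.m_pos x).ne']
    exact mul_le_mul_of_nonneg_left (abs_sub _ _) (G.w_nonneg x y)
  have hy : ∀ x, (∑' y, ENNReal.ofReal (G.w x y)) * ENNReal.ofReal |g x| ≤
      ENNReal.ofReal D * ENNReal.ofReal (G.m x * |g x|) := fun x => by
    rw [ENNReal.ofReal_mul (G.m_pos x).le, ← mul_assoc, ← ENNReal.ofReal_mul hD0]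
    exact mul_le_mul_left (G.tsum_w_le hD x) _
  refine (ENNReal.tsum_le_tsum hx).trans ?_
  rw [ENNReal.tsum_add, ENNReal.tsum_comm]
  simp only [ENNReal.tsum_mul_right]
  have h2 := ENNReal.tsum_le_tsum hy
  rw [ENNReal.tsum_mul_left] at h2
  calc _ ≤ ENNReal.ofReal D * G.norm1 g + ENNReal.ofReal D * G.norm1 g := by
        refine add_le_add (le_trans (le_of_eq ?_) h2) h2
        refine tsum_congr fun y => ?_
        congr 1
        exact tsum_congr fun x => by rw [G.w_symm x y]
    _ = _ := by rw [← add_mul, ← ENNReal.ofReal_add hD0 hD0, two_mul]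

lemma summable_heat_of_grad (hG : G.BoundedDegree) {f : V → ℝ}
    (hf : G.norm1 (fun x => Real.sqrt (G.Gam f f x)) ≠ ∞) (t : ℝ) (x : V) :
    Summable fun n : ℕ => t ^ n / n ! * (G.lap^[n] f) x := by
  obtain ⟨D, hD⟩ := hG
  have hD' : ∀ x, G.deg x ≤ D := fun x => hD ⟨x, rfl⟩
  have hD0 : 0 ≤ D := (Finset.sum_nonneg fun y _ => G.q_nonneg x y).trans (hD' x)
  have h1 : G.norm1 (G.lap f) ≠ ∞ := by
    refine ne_top_of_le_ne_top (ENNReal.mul_ne_top (ENNReal.ofReal_ne_top (r := √(2 * D))) hf) ?_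
    rw [norm1, norm1, ← ENNReal.tsum_mul_left]
    refine ENNReal.tsum_le_tsum fun x => ?_
    rw [← ENNReal.ofReal_mul (Real.sqrt_nonneg _), abs_of_nonneg (Real.sqrt_nonneg _)]
    refine ENNReal.ofReal_le_ofReal ?_
    have := mul_le_mul_of_nonneg_left (G.abs_lap_le_sqrt_Gam hD' f x) (G.m_pos x).le
    linarith
  have h2 : ∀ n, G.norm1 (G.lap^[n + 1] f) ≤
      ENNReal.ofReal ((2 * D) ^ n) * G.norm1 (G.lap f) := by
    intro n
    induction n with
    | zero => simp
    | succ n ih =>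
      rw [Function.iterate_succ_apply', pow_succ', ENNReal.ofReal_mul (by positivity), mul_assoc]
      exact (G.norm1_lap_le hD0 hD' _).trans (by gcongr)
  have h3 : ∀ n, |(G.lap^[n + 1] f) x| ≤ (2 * D) ^ n * ((G.norm1 (G.lap f)).toReal / G.m x) := by
    intro n
    have h := (ENNReal.le_tsum x).trans (h2 n)
    rw [← ENNReal.ofReal_toReal h1, ← ENNReal.ofReal_mul (by positivity),
      ENNReal.ofReal_le_ofReal_iff (by positivity)] at h
    rw [← mul_div_assoc, le_div_iff₀ (G.m_pos x)]
    linarith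
  set N := (G.norm1 (G.lap f)).toReal / G.m x
  have hN : 0 ≤ N := div_nonneg ENNReal.toReal_nonneg (G.m_pos x).le
  refine summable_of_pow_bound (B := 2 * D + 1) (C := |f x| + N) t fun n => ?_
  cases n with
  | zero => simpa using hN
  | succ n =>
    refine (h3 n).trans ?_
    have : (2 * D) ^ n ≤ (2 * D + 1) ^ (n + 1) :=
      (pow_le_pow_left₀ (by positivity) (by linarith) n).trans
        (pow_le_pow_right₀ (by linarith) (Nat.le_succ n))
    exact mul_le_mul this (by linarith [abs_nonneg (f x)]) hN (by positivity)

end MWGraph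

/-! The proof is by duality with `ℓ^∞`. Testing `P_t f - f` against a finitely supported `g` with
`‖g‖_∞ ≤ 1` gives `-∫₀ᵗ ∑ m Γ(f, P_s g) ds`, so by Cauchy-Schwarz for `Γ` a bound `√Γ(P_s g) ≤
√(2/s)` suffices; integrating it yields `2√2 √t`.

The gradient bound (`mul_Gam_heat_le`) is a reverse Poincaré inequality. With `u = P_{t-s} g`, the
quantity `u² + 2(t-s)Γu` is transported by the Feynman-Kac semigroup of `Δ + 2W - 2K`, where `W` is
a truncation of `(ρ-K)_-`. The potential absorbs the curvature term in Bochner's formula, and only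
an error of size `2K‖g‖²` is left. That error is integrable in time because the semigroup applied to
`1` is at most `2e^{-Kt}` (`opExp_schr_decay`). This decay is Khas'minskii's lemma: the Kato
condition bounds the growth of `e^{t(Δ+2W)} 1` over one period `T`, the semigroup law iterates this,
and the factor `e^{-2Kt}` wins.

Truncating is harmless since bounded degree already forces `Γ₂ ≥ -DΓ` (`neg_mul_Gam_le_Gam2`). All
operators are then bounded on `ℓ^∞`, modelled as `V →ᵇ ℝ` with `V` discrete, and their semigroups
are exponential series. -/

open scoped BoundedContinuousFunction

/-! ### Exponentials of bounded operators -/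

section OperatorExponential

variable {F : Type*} [NormedAddCommGroup F] [NormedSpace ℝ F]

/-- The uniformly continuous semigroup `e^{tA}` generated by a bounded operator `A`. -/
noncomputable def opExp (A : F →L[ℝ] F) (t : ℝ) : F →L[ℝ] F := NormedSpace.exp (t • A)

@[simp] lemma opExp_zero (A : F →L[ℝ] F) : opExp A 0 = 1 := by simp [opExp]

variable [CompleteSpace F]

lemma hasDerivAt_opExp (A : F →L[ℝ] F) (t : ℝ) :
    HasDerivAt (opExp A) (opExp A t * A) t := hasDerivAt_exp_smul_const A t

lemma hasDerivAt_opExp' (A : F →L[ℝ] F) (t : ℝ) :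
    HasDerivAt (opExp A) (A * opExp A t) t := hasDerivAt_exp_smul_const' A t

lemma hasDerivAt_opExp_apply (A : F →L[ℝ] F) (g : F) (t : ℝ) :
    HasDerivAt (fun s => opExp A s g) (A (opExp A t g)) t := by
  simpa using (hasDerivAt_opExp' A t).clm_apply (hasDerivAt_const t g)

lemma hasDerivAt_opExp_sub_apply (A : F →L[ℝ] F) (g : F) (t s : ℝ) :
    HasDerivAt (fun r => opExp A (t - r) g) (-A (opExp A (t - s) g)) s := by
  have h := (hasDerivAt_opExp_apply A g (t - s)).scomp s ((hasDerivAt_id s).const_sub t)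
  simpa [Function.comp_def] using h

lemma continuous_opExp_apply (A : F →L[ℝ] F) (g : F) : Continuous fun s => opExp A s g :=
  continuous_iff_continuousAt.2 fun s => (hasDerivAt_opExp_apply A g s).continuousAt

lemma opExp_add (A : F →L[ℝ] F) (s t : ℝ) : opExp A (s + t) = opExp A s * opExp A t := by
  let _ : NormedAlgebra ℚ (F →L[ℝ] F) := NormedAlgebra.restrictScalars ℚ ℝ _
  rw [opExp, add_smul]
  exact NormedSpace.exp_add_of_commute (((Commute.refl A).smul_left s).smul_right t)

/-- Serves twice: to shift a generator until it preserves positivity, and to split a constant off a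
potential. -/
lemma opExp_add_smul_one (A : F →L[ℝ] F) (c t : ℝ) :
    opExp (A + c • 1) t = Real.exp (c * t) • opExp A t := by
  let _ : NormedAlgebra ℚ (F →L[ℝ] F) := NormedAlgebra.restrictScalars ℚ ℝ _
  have h1 : NormedSpace.exp ((t * c) • (1 : F →L[ℝ] F)) = Real.exp (c * t) • 1 := by
    have := NormedSpace.algebraMap_exp_comm (𝕂 := ℝ) (𝔸 := F →L[ℝ] F) (t * c)
    rw [← Real.exp_eq_exp_ℝ, Algebra.algebraMap_eq_smul_one, Algebra.algebraMap_eq_smul_one] at this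
    rw [← this, mul_comm]
  rw [opExp, smul_add, smul_smul, NormedSpace.exp_add_of_commute
    ((Commute.one_right (t • A)).smul_right _), h1, opExp]
  simp

lemma hasSum_opExp_apply (A : F →L[ℝ] F) (t : ℝ) (g : F) :
    HasSum (fun n : ℕ => (t ^ n / n !) • (A ^ n) g) (opExp A t g) := by
  have h := (NormedSpace.exp_series_hasSum_exp' (𝕂 := ℝ) (t • A)).mapL
    (ContinuousLinearMap.apply ℝ F g)
  convert h using 2 with n
  · simp [smul_pow, smul_smul, div_eq_inv_mul]
  · rfl

end OperatorExponential

/-! ### Positivity of heat and Schrödinger semigroups on `ℓ^∞` -/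

namespace MWGraph

variable {V : Type*} [TopologicalSpace V]

lemma hasSum_opExp_apply_apply (A : (V →ᵇ ℝ) →L[ℝ] (V →ᵇ ℝ)) (t : ℝ) (g : V →ᵇ ℝ) (x : V) :
    HasSum (fun n : ℕ => t ^ n / n ! * (A ^ n) g x) (opExp A t g x) := by
  simpa using (hasSum_opExp_apply A t g).mapL (BoundedContinuousFunction.evalCLM ℝ x)

/-- `e^{tA}` is positivity preserving if `A + c` is, for some constant `c`. -/
lemma opExp_nonneg {A : (V →ᵇ ℝ) →L[ℝ] (V →ᵇ ℝ)} {c : ℝ}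
    (hA : ∀ h : V →ᵇ ℝ, (∀ x, 0 ≤ h x) → ∀ x, 0 ≤ A h x + c * h x) {t : ℝ} (ht : 0 ≤ t)
    {h : V →ᵇ ℝ} (hh : ∀ x, 0 ≤ h x) (x : V) : 0 ≤ opExp A t h x := by
  -- After the shift every term of the exponential series is nonnegative; undoing the shift only
  -- costs the positive factor `e^{-ct}`.
  have e : A = (A + c • (1 : (V →ᵇ ℝ) →L[ℝ] (V →ᵇ ℝ))) + (-c) • 1 := by module
  rw [e, opExp_add_smul_one]
  refine mul_nonneg (Real.exp_pos _).le ?_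
  have hpow : ∀ n x, 0 ≤ ((A + c • (1 : (V →ᵇ ℝ) →L[ℝ] (V →ᵇ ℝ))) ^ n) h x := by
    intro n
    induction n with
    | zero => simpa using hh
    | succ n ih => rw [pow_succ']; exact hA _ ih
  exact (hasSum_opExp_apply_apply _ t h x).nonneg fun n => mul_nonneg (by positivity) (hpow n x)

variable [DiscreteTopology V] (G : MWGraph V)

lemma deg_nonneg {V : Type*} (G : MWGraph V) (x : V) : 0 ≤ G.deg x :=
  Finset.sum_nonneg fun y _ => G.q_nonneg x y

lemma abs_lap_le_of_bounded {V : Type*} (G : MWGraph V) {D : ℝ} (hD : ∀ x, G.deg x ≤ D)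
    {f : V → ℝ} {C : ℝ} (hC : ∀ x, |f x| ≤ C) (x : V) : |G.lap f x| ≤ 2 * D * C := by
  have hC0 : 0 ≤ C := (abs_nonneg _).trans (hC x)
  calc |G.lap f x| ≤ ∑ y ∈ G.nbrs x, G.q x y * |f y - f x| := G.abs_lap_le f x
    _ ≤ ∑ y ∈ G.nbrs x, G.q x y * (2 * C) := by
        refine Finset.sum_le_sum fun y _ => mul_le_mul_of_nonneg_left ?_ (G.q_nonneg x y)
        linarith [abs_sub (f y) (f x), hC x, hC y]
    _ = G.deg x * (2 * C) := by rw [deg, Finset.sum_mul]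
    _ ≤ D * (2 * C) := mul_le_mul_of_nonneg_right (hD x) (by linarith)
    _ = _ := by ring

/-- The Laplacian of a graph of bounded degree as a bounded operator on `ℓ^∞(V)`. -/
noncomputable def lapL {D : ℝ} (hD : ∀ x, G.deg x ≤ D) : (V →ᵇ ℝ) →L[ℝ] (V →ᵇ ℝ) :=
  LinearMap.mkContinuousOfExistsBound
    { toFun := fun h => BoundedContinuousFunction.ofNormedAddCommGroupDiscrete (G.lap h)
        (2 * D * ‖h‖) (G.abs_lap_le_of_bounded hD h.norm_coe_le_norm)
      map_add' := fun f g => by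
        ext x
        simp only [lap, BoundedContinuousFunction.coe_add, Pi.add_apply,
          BoundedContinuousFunction.coe_ofNormedAddCommGroupDiscrete, ← Finset.sum_add_distrib]
        exact Finset.sum_congr rfl fun y _ => by ring
      map_smul' := fun c f => by
        ext x
        simp only [lap, BoundedContinuousFunction.coe_smul, smul_eq_mul, RingHom.id_apply,
          BoundedContinuousFunction.coe_ofNormedAddCommGroupDiscrete, Finset.mul_sum]
        exact Finset.sum_congr rfl fun y _ => by ring }
    ⟨max (2 * D) 0, fun h => (BoundedContinuousFunction.norm_le (by positivity)).2 fun x =>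
      (G.abs_lap_le_of_bounded hD h.norm_coe_le_norm x).trans
        (mul_le_mul_of_nonneg_right (le_max_left _ _) (norm_nonneg h))⟩

@[simp] lemma lapL_apply {D : ℝ} (hD : ∀ x, G.deg x ≤ D) (h : V →ᵇ ℝ) (x : V) :
    G.lapL hD h x = G.lap h x := rfl

/-- The Schrödinger operator `Δ + v` on `ℓ^∞(V)`. -/
noncomputable def schr {D : ℝ} (hD : ∀ x, G.deg x ≤ D) (v : V →ᵇ ℝ) :
    (V →ᵇ ℝ) →L[ℝ] (V →ᵇ ℝ) := G.lapL hD + ContinuousLinearMap.mul ℝ (V →ᵇ ℝ) v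

@[simp] lemma schr_apply {D : ℝ} (hD : ∀ x, G.deg x ≤ D) (v h : V →ᵇ ℝ) (x : V) :
    G.schr hD v h x = G.lap h x + v x * h x := rfl

lemma lap_one {V : Type*} (G : MWGraph V) : G.lap 1 = 0 := by
  ext x; simp [lap]

variable {D : ℝ} (hD : ∀ x, G.deg x ≤ D)

lemma coe_lapL_pow (n : ℕ) (g : V →ᵇ ℝ) : ⇑((G.lapL hD ^ n) g) = G.lap^[n] g := by
  induction n with
  | zero => simp
  | succ n ih => rw [pow_succ', Function.iterate_succ_apply', ← ih]; rfl

lemma opExp_lapL_apply (t : ℝ) (g : V →ᵇ ℝ) (x : V) :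
    opExp (G.lapL hD) t g x = G.heat t g x := by
  rw [← (hasSum_opExp_apply_apply (G.lapL hD) t g x).tsum_eq, heat]
  simp only [coe_lapL_pow]

lemma opExp_schr_nonneg (v : V →ᵇ ℝ) {t : ℝ} (ht : 0 ≤ t) {h : V →ᵇ ℝ} (hh : ∀ x, 0 ≤ h x)
    (x : V) : 0 ≤ opExp (G.schr hD v) t h x := by
  -- `D` compensates the diagonal part `-deg` of the Laplacian, `‖v‖` the negative part of the
  -- potential.
  refine opExp_nonneg (c := D + ‖v‖) (fun h hh x => ?_) ht hh x
  have h1 : G.lap h x = ∑ y ∈ G.nbrs x, G.q x y * h y - G.deg x * h x := by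
    simp only [lap, deg, Finset.sum_mul, ← Finset.sum_sub_distrib, mul_sub]
  have h2 : 0 ≤ ∑ y ∈ G.nbrs x, G.q x y * h y :=
    Finset.sum_nonneg fun y _ => mul_nonneg (G.q_nonneg x y) (hh y)
  have h3 : 0 ≤ (D - G.deg x) * h x := mul_nonneg (sub_nonneg.2 (hD x)) (hh x)
  have h4 : 0 ≤ (‖v‖ + v x) * h x :=
    mul_nonneg (by linarith [neg_abs_le (v x), v.norm_coe_le_norm x, Real.norm_eq_abs (v x)]) (hh x)
  rw [schr_apply, h1]
  linarith

lemma opExp_schr_mono (v : V →ᵇ ℝ) {t : ℝ} (ht : 0 ≤ t) {g h : V →ᵇ ℝ} (hgh : ∀ x, g x ≤ h x)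
    (x : V) : opExp (G.schr hD v) t g x ≤ opExp (G.schr hD v) t h x := by
  have := G.opExp_schr_nonneg hD v ht (h := h - g) (fun y => by simpa using hgh y) x
  simpa using this

lemma abs_opExp_schr_le (v : V →ᵇ ℝ) {t : ℝ} (ht : 0 ≤ t) {h : V →ᵇ ℝ} {C : ℝ}
    (hC : ∀ x, |h x| ≤ C) (x : V) :
    |opExp (G.schr hD v) t h x| ≤ C * opExp (G.schr hD v) t 1 x := by
  have h1 := G.opExp_schr_mono hD v ht (g := h) (h := C • 1)
    (fun y => by simpa using (abs_le.1 (hC y)).2) x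
  have h2 := G.opExp_schr_mono hD v ht (g := (-C) • 1) (h := h)
    (fun y => by simpa using (abs_le.1 (hC y)).1) x
  simp only [map_smul, BoundedContinuousFunction.coe_smul, smul_eq_mul] at h1 h2
  exact abs_le.2 ⟨by linarith, h1⟩

lemma schr_zero : G.schr hD 0 = G.lapL hD := by simp [schr]

lemma opExp_lapL_one {t : ℝ} : opExp (G.lapL hD) t 1 = 1 := by
  have h0 : G.lapL hD 1 = 0 := by
    ext x; rw [lapL_apply, BoundedContinuousFunction.coe_one, lap_one]; rfl
  have h := hasSum_opExp_apply (G.lapL hD) t 1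
  refine h.unique ?_
  have h1 : ∀ n ≠ 0, (t ^ n / n !) • ((G.lapL hD) ^ n) (1 : V →ᵇ ℝ) = 0 := fun n hn => by
    obtain ⟨k, rfl⟩ := Nat.exists_eq_succ_of_ne_zero hn
    simp [pow_succ, h0]
  simpa using hasSum_single 0 h1

lemma abs_opExp_lapL_le {t : ℝ} (ht : 0 ≤ t) {h : V →ᵇ ℝ} {C : ℝ}
    (hC : ∀ x, |h x| ≤ C) (x : V) : |opExp (G.lapL hD) t h x| ≤ C := by
  have := G.abs_opExp_schr_le hD 0 ht hC x
  simpa [schr_zero, opExp_lapL_one] using this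

end MWGraph

/-! ### Curvature and the reverse Poincaré inequality -/

namespace MWGraph

section Curvature

variable {V : Type*} (G : MWGraph V)

lemma Gam_eq_sum (f g : V → ℝ) (x : V) :
    G.Gam f g x = 1 / 2 * ∑ y ∈ G.nbrs x, G.q x y * ((f y - f x) * (g y - g x)) := by
  simp only [Gam, lap, Pi.mul_apply, Finset.mul_sum, ← Finset.sum_sub_distrib]
  exact Finset.sum_congr rfl fun y _ => by ring

lemma Gam_self_nonneg (f : V → ℝ) (x : V) : 0 ≤ G.Gam f f x := by
  rw [Gam_self]
  exact mul_nonneg (by norm_num)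
    (Finset.sum_nonneg fun y _ => mul_nonneg (G.q_nonneg x y) (sq_nonneg _))

lemma two_mul_Gam2_self (f : V → ℝ) (x : V) :
    2 * G.Gam2 f f x = G.lap (G.Gam f f) x - 2 * G.Gam f (G.lap f) x := by
  rw [Gam2]; ring

lemma sq_lap_le {D : ℝ} (hD : ∀ x, G.deg x ≤ D) (f : V → ℝ) (x : V) :
    (G.lap f x) ^ 2 ≤ 2 * D * G.Gam f f x := by
  have h0 : 0 ≤ 2 * D := by linarith [G.deg_nonneg x, hD x]
  have h := pow_le_pow_left₀ (abs_nonneg _) (G.abs_lap_le_sqrt_Gam hD f x) 2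
  rwa [sq_abs, mul_pow, Real.sq_sqrt h0, Real.sq_sqrt (G.Gam_self_nonneg f x)] at h

/-- Bounded degree bounds the curvature from below. -/
lemma neg_mul_Gam_le_Gam2 {D : ℝ} (hD0 : 0 < D) (hD : ∀ x, G.deg x ≤ D) (f : V → ℝ) (x : V) :
    -D * G.Gam f f x ≤ G.Gam2 f f x := by
  -- Completing the square: with `d = f y - f x`, the bound `(Δf(y))² ≤ 2DΓf(y)` makes `Γf(y) -
  -- dΔf(y) + (D/2)d²` nonnegative. Summed over `y`, this gives `2Γ₂f ≥ -(deg + D)Γf + (Δf)²`.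
  have key : ∀ y, -G.Gam f f x - D / 2 * (f y - f x) ^ 2 + (f y - f x) * G.lap f x ≤
      (G.Gam f f y - G.Gam f f x) - (f y - f x) * (G.lap f y - G.lap f x) := by
    intro y
    have h1 := G.sq_lap_le hD f y
    have h2 : 0 ≤ (D * (f y - f x) - G.lap f y) ^ 2 := sq_nonneg _
    have h3 : 0 ≤ 2 * D * (D / 2 * (f y - f x) ^ 2 + G.Gam f f y - (f y - f x) * G.lap f y) := by
      nlinarith
    have h4 := nonneg_of_mul_nonneg_right h3 (by positivity)
    linarith
  have hs : ∑ y ∈ G.nbrs x,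
        G.q x y * (-G.Gam f f x - D / 2 * (f y - f x) ^ 2 + (f y - f x) * G.lap f x) ≤
      ∑ y ∈ G.nbrs x, G.q x y *
        ((G.Gam f f y - G.Gam f f x) - (f y - f x) * (G.lap f y - G.lap f x)) :=
    Finset.sum_le_sum fun y _ => mul_le_mul_of_nonneg_left (key y) (G.q_nonneg x y)
  have el : ∑ y ∈ G.nbrs x,
        G.q x y * (-G.Gam f f x - D / 2 * (f y - f x) ^ 2 + (f y - f x) * G.lap f x) =
      -G.deg x * G.Gam f f x - D * G.Gam f f x + G.lap f x ^ 2 := by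
    have e : D * G.Gam f f x = D / 2 * ∑ y ∈ G.nbrs x, G.q x y * (f y - f x) ^ 2 := by
      rw [Gam_self]; ring
    have e1 : -G.deg x * G.Gam f f x = ∑ y ∈ G.nbrs x, G.q x y * -G.Gam f f x := by
      rw [deg, ← Finset.sum_mul]; ring
    have e2 : G.lap f x ^ 2 = ∑ y ∈ G.nbrs x, G.q x y * (f y - f x) * G.lap f x := by
      rw [← Finset.sum_mul, sq]; rfl
    rw [e, e1, e2, Finset.mul_sum, ← Finset.sum_sub_distrib, ← Finset.sum_add_distrib]
    exact Finset.sum_congr rfl fun y _ => by ring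
  have er : ∑ y ∈ G.nbrs x, G.q x y *
        ((G.Gam f f y - G.Gam f f x) - (f y - f x) * (G.lap f y - G.lap f x)) =
      2 * G.Gam2 f f x := by
    have e1 : 2 * G.Gam f (G.lap f) x =
        ∑ y ∈ G.nbrs x, G.q x y * ((f y - f x) * (G.lap f y - G.lap f x)) := by
      rw [Gam_eq_sum]; ring
    have e2 : G.lap (G.Gam f f) x = ∑ y ∈ G.nbrs x, G.q x y * (G.Gam f f y - G.Gam f f x) := rfl
    rw [two_mul_Gam2_self, e1, e2, ← Finset.sum_sub_distrib]
    exact Finset.sum_congr rfl fun y _ => by ring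
  rw [el, er] at hs
  nlinarith [sq_nonneg (G.lap f x), mul_nonneg (sub_nonneg.2 (hD x)) (G.Gam_self_nonneg f x)]

end Curvature

variable {V : Type*} [TopologicalSpace V]

lemma hasDerivAt_eval {u : ℝ → V →ᵇ ℝ} {u' : V →ᵇ ℝ} {s : ℝ} (hu : HasDerivAt u u' s) (x : V) :
    HasDerivAt (fun r => u r x) (u' x) s :=
  (BoundedContinuousFunction.evalCLM ℝ x (α := V) (β := ℝ)).hasFDerivAt.comp_hasDerivAt s hu

lemma le_of_hasDerivAt_nonneg {f f' : ℝ → ℝ} {a b : ℝ} (hab : a ≤ b)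
    (hf : ∀ s, HasDerivAt f (f' s) s) (h : ∀ s, a ≤ s → s ≤ b → 0 ≤ f' s) : f a ≤ f b := by
  refine monotoneOn_of_deriv_nonneg (convex_Icc a b)
    (fun s _ => (hf s).continuousAt.continuousWithinAt)
    (fun s _ => (hf s).differentiableAt.differentiableWithinAt) (fun s hs => ?_)
    (Set.left_mem_Icc.2 hab) (Set.right_mem_Icc.2 hab) hab
  rw [interior_Icc] at hs
  rw [(hf s).deriv]
  exact h s hs.1.le hs.2.le

variable [DiscreteTopology V] (G : MWGraph V)
variable {D : ℝ} (hD : ∀ x, G.deg x ≤ D)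

/-- The carré du champ operator on `ℓ^∞(V)`. -/
noncomputable def GamL (f g : V →ᵇ ℝ) : V →ᵇ ℝ :=
  (1 / 2 : ℝ) • (G.lapL hD (f * g) - f * G.lapL hD g - g * G.lapL hD f)

lemma coe_GamL (f g : V →ᵇ ℝ) : ⇑(G.GamL hD f g) = G.Gam f g := rfl

lemma hasDerivAt_GamL_self {u : ℝ → V →ᵇ ℝ} {u' : V →ᵇ ℝ} {s : ℝ} (hu : HasDerivAt u u' s) :
    HasDerivAt (fun r => G.GamL hD (u r) (u r)) ((2 : ℝ) • G.GamL hD (u s) u') s := by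
  have hL : HasDerivAt (fun r => G.lapL hD (u r)) (G.lapL hD u') s :=
    (G.lapL hD).hasFDerivAt.comp_hasDerivAt s hu
  have hL2 : HasDerivAt (fun r => G.lapL hD (u r * u r)) (G.lapL hD (u' * u s + u s * u')) s :=
    (G.lapL hD).hasFDerivAt.comp_hasDerivAt s (hu.mul hu)
  have e : (2 : ℝ) • G.GamL hD (u s) u' = (1 / 2 : ℝ) • (G.lapL hD (u' * u s + u s * u') -
      (u' * G.lapL hD (u s) + u s * G.lapL hD u') - (u' * G.lapL hD (u s) + u s * G.lapL hD u')) := by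
    simp only [GamL, mul_comm u' (u s), map_add]
    module
  rw [e]
  exact ((hL2.sub (hu.mul hL)).sub (hu.mul hL)).const_smul (1 / 2 : ℝ)

/-- The reverse Poincaré inequality: `t Γ(P_t g) ≤ 2 ‖g‖²` under `CD(K - W, ∞)` if the Feynman-Kac
semigroup with potential `2W - 2K` decays exponentially. -/
theorem mul_Gam_heat_le {K : ℝ} (hK : 0 < K) {W : V →ᵇ ℝ} (hW : ∀ x, 0 ≤ W x)
    (hCD : ∀ (u : V →ᵇ ℝ) x, (K - W x) * G.Gam u u x ≤ G.Gam2 u u x)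
    (hQ : ∀ t, 0 ≤ t → ∀ x, opExp (G.schr hD ((2 : ℝ) • W - (2 * K) • 1)) t 1 x ≤
      2 * Real.exp (-(K * t)))
    (g : V →ᵇ ℝ) {t : ℝ} (ht : 0 ≤ t) (x : V) :
    t * G.Gam (opExp (G.lapL hD) t g) (opExp (G.lapL hD) t g) x ≤ 2 * ‖g‖ ^ 2 := by
  set v : V →ᵇ ℝ := (2 : ℝ) • W - (2 * K) • 1 with hv
  set u : ℝ → V →ᵇ ℝ := fun s => opExp (G.lapL hD) (t - s) g with hu
  -- The weight `2(t-s)` is chosen so that its derivative `-2Γu` cancels `Δ(u²) - 2uΔu = 2Γu`. It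
  -- vanishes at `s = t`, leaving only `u²` there.
  set F : ℝ → V →ᵇ ℝ := fun s => u s * u s + (2 * (t - s)) • G.GamL hD (u s) (u s) with hF
  have hu' : ∀ s, HasDerivAt u (-G.lapL hD (u s)) s := hasDerivAt_opExp_sub_apply _ g t
  set F' : ℝ → V →ᵇ ℝ := fun s => (-G.lapL hD (u s) * u s + u s * -G.lapL hD (u s)) +
    ((2 * (t - s)) • ((2 : ℝ) • G.GamL hD (u s) (-G.lapL hD (u s))) +
      (-2 : ℝ) • G.GamL hD (u s) (u s)) with hF'
  have hFd : ∀ s, HasDerivAt F (F' s) s := fun s => by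
    have h1 : HasDerivAt (fun s : ℝ => 2 * (t - s)) (-2) s := by
      simpa using ((hasDerivAt_id s).const_sub t).const_mul 2
    exact ((hu' s).mul (hu' s)).add (h1.smul (G.hasDerivAt_GamL_self hD (hu' s)))
  have hub : ∀ s, s ≤ t → ∀ y, |u s y| ≤ ‖g‖ := fun s hs y =>
    G.abs_opExp_lapL_le hD (sub_nonneg.2 hs) g.norm_coe_le_norm y
  have hub2 : ∀ s, s ≤ t → ∀ y, u s y * u s y ≤ ‖g‖ ^ 2 := fun s hs y => by
    rw [← sq, ← sq_abs]; exact pow_le_pow_left₀ (abs_nonneg _) (hub s hs y) 2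
  set Q := opExp (G.schr hD v)
  have hQ0 : ∀ s, 0 ≤ s → ∀ h : V →ᵇ ℝ, ∀ c : ℝ, (∀ y, c ≤ h y) → c * Q s 1 x ≤ Q s h x := by
    intro s hs h c hc
    have := G.opExp_schr_mono hD v hs (g := c • 1) (h := h) (fun y => by simpa using hc y) x
    simpa using this
  -- By `e1` and the curvature bound the `Γ` terms are nonnegative, and `v u² ≥ -2K u²` since `W ≥
  -- 0`.
  have hpt : ∀ s, s ≤ t → ∀ y, -(2 * K * ‖g‖ ^ 2) ≤ (G.schr hD v (F s) + F' s) y := by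
    intro s hs y
    have e1 : (G.schr hD v (F s) + F' s) y =
        v y * (u s y * u s y) +
          2 * (t - s) * (v y * G.Gam (u s) (u s) y + 2 * G.Gam2 (u s) (u s) y) := by
      have hlap : G.lap (F s) y = G.lap (u s * u s) y + 2 * (t - s) * G.lap (G.Gam (u s) (u s)) y := by
        have : G.lapL hD (F s) = G.lapL hD (u s * u s) +
          (2 * (t - s)) • G.lapL hD (G.GamL hD (u s) (u s)) := by rw [hF, map_add, map_smul]
        exact congrArg (fun h : V →ᵇ ℝ => h y) this
      have hΓ : G.Gam (u s) (-G.lap (u s)) y = -G.Gam (u s) (G.lap (u s)) y := by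
        rw [Gam_eq_sum, Gam_eq_sum, ← mul_neg, ← Finset.sum_neg_distrib]
        congr 1
        exact Finset.sum_congr rfl fun z _ => by simp only [Pi.neg_apply]; ring
      have hΓ1 : 2 * G.Gam (u s) (u s) y = G.lap (u s * u s) y - 2 * (u s y * G.lap (u s) y) := by
        rw [Gam]; ring
      have hFy : F s y = u s y * u s y + 2 * (t - s) * G.Gam (u s) (u s) y := rfl
      have hFy' : F' s y = (-G.lap (u s) y * u s y + u s y * -G.lap (u s) y) +
        (2 * (t - s) * (2 * G.Gam (u s) (-G.lap (u s)) y) + -2 * G.Gam (u s) (u s) y) := rfl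
      rw [BoundedContinuousFunction.coe_add, Pi.add_apply, schr_apply, hlap, hFy, hFy', hΓ,
        two_mul_Gam2_self]
      linarith
    have e2 : v y = 2 * W y - 2 * K := by simp [hv]
    rw [e1, e2]
    have h1 : 0 ≤ (t - s) * (G.Gam2 (u s) (u s) y - (K - W y) * G.Gam (u s) (u s) y) :=
      mul_nonneg (sub_nonneg.2 hs) (sub_nonneg.2 (hCD _ y))
    have h2 : 0 ≤ W y * (u s y * u s y) := mul_nonneg (hW y) (mul_self_nonneg _)
    have h3 := mul_le_mul_of_nonneg_left (hub2 s hs y) hK.le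
    linarith
  -- The correction is a primitive of the error bound `2K‖g‖² · 2e^{-Ks}`. Comparing `s = 0` with `s
  -- = t` gives `u² + 2tΓu ≤ 4‖g‖² - 2‖g‖² e^{-Kt}` at `s = 0`.
  have hmono := le_of_hasDerivAt_nonneg (a := 0) (b := t) ht
    (f := fun s => Q s (F s) x - 4 * ‖g‖ ^ 2 * Real.exp (-(K * s)))
    (f' := fun s => Q s (G.schr hD v (F s) + F' s) x -
      4 * ‖g‖ ^ 2 * (Real.exp (-(K * s)) * -K)) (fun s => ?_) (fun s hs hst => ?_)
  · have h0 : Q 0 (F 0) x = u 0 x * u 0 x + 2 * t * G.Gam (u 0) (u 0) x := by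
      simp only [Q, opExp_zero]
      simp [hF, coe_GamL]
    have h1 : Q t (F t) x ≤ ‖g‖ ^ 2 * (2 * Real.exp (-(K * t))) := by
      have h2 := hQ0 t ht (-F t) (-‖g‖ ^ 2) (fun y => by
        have := hub2 t le_rfl y
        simp [hF]; linarith)
      rw [map_neg, BoundedContinuousFunction.coe_neg, Pi.neg_apply] at h2
      nlinarith [mul_le_mul_of_nonneg_left (hQ t ht x) (sq_nonneg ‖g‖)]
    have h2 : u 0 = opExp (G.lapL hD) t g := by simp [hu]
    simp only [mul_zero, neg_zero, Real.exp_zero] at hmono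
    rw [h0, h2] at hmono
    have h3 : 0 ≤ ‖g‖ ^ 2 * Real.exp (-(K * t)) := by positivity
    nlinarith [mul_self_nonneg (opExp (G.lapL hD) t g x)]
  · refine HasDerivAt.sub ?_ ?_
    · have := hasDerivAt_eval ((hasDerivAt_opExp (G.schr hD v) s).clm_apply (hFd s)) x
      simpa using this
    · have := ((((hasDerivAt_id s).const_mul K).neg).exp).const_mul (4 * ‖g‖ ^ 2)
      simpa using this
  · have h1 := hQ0 s hs _ _ (hpt s hst)
    have h2 := mul_le_mul_of_nonneg_left (hQ s hs x) (by positivity : 0 ≤ 2 * K * ‖g‖ ^ 2)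
    linarith

end MWGraph

/-! ### Khas'minskii's lemma and decay of the Feynman-Kac semigroup -/

namespace MWGraph

variable {V : Type*} [TopologicalSpace V]

lemma ofReal_norm_le_supNorm (h : V →ᵇ ℝ) : ENNReal.ofReal ‖h‖ ≤ supNorm h := by
  by_cases htop : supNorm h = ∞
  · rw [htop]; exact le_top
  · refine ENNReal.ofReal_le_of_le_toReal
      ((BoundedContinuousFunction.norm_le ENNReal.toReal_nonneg).2 fun x => ?_)
    exact (ENNReal.ofReal_le_iff_le_toReal htop).1 (le_iSup (fun x => ENNReal.ofReal |h x|) x)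

variable [DiscreteTopology V] (G : MWGraph V)
variable {D : ℝ} (hD : ∀ x, G.deg x ≤ D)

lemma schr_one (v : V →ᵇ ℝ) : G.schr hD v 1 = v := by
  ext x
  rw [schr_apply, BoundedContinuousFunction.coe_one, lap_one]
  simp

/-- Since `(Δ + v)1 = v`, the time derivative is `e^{r(Δ+v)} v`, which is nonnegative by positivity.
-/
lemma opExp_schr_one_mono {v : V →ᵇ ℝ} (hv : ∀ x, 0 ≤ v x) {s t : ℝ} (hs : 0 ≤ s) (hst : s ≤ t)
    (x : V) : opExp (G.schr hD v) s 1 x ≤ opExp (G.schr hD v) t 1 x := by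
  refine le_of_hasDerivAt_nonneg hst (f := fun r => opExp (G.schr hD v) r 1 x)
    (f' := fun r => opExp (G.schr hD v) r v x) (fun r => ?_)
    (fun r hr _ => G.opExp_schr_nonneg hD v (hs.trans hr) hv x)
  have := hasDerivAt_eval ((hasDerivAt_opExp (G.schr hD v) r).clm_apply
    (hasDerivAt_const r (1 : V →ᵇ ℝ))) x
  simpa [schr_one] using this

/-- Khas'minskii's lemma: `‖e^{T(Δ+2W)} 1‖ (1 - 2 ∫₀ᵀ ‖P_s W‖ ds) ≤ 1`. -/
lemma norm_opExp_schr_one_le {W : V →ᵇ ℝ} (hW : ∀ x, 0 ≤ W x) {T : ℝ} (hT : 0 ≤ T) :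
    ‖opExp (G.schr hD ((2 : ℝ) • W)) T 1‖ ≤ 1 + 2 * ‖opExp (G.schr hD ((2 : ℝ) • W)) T 1‖ *
      ∫ s in (0 : ℝ)..T, ‖opExp (G.lapL hD) s W‖ := by
  set R := opExp (G.schr hD ((2 : ℝ) • W)) with hR
  set P := opExp (G.lapL hD) with hP
  set β := ‖R T 1‖ with hβ
  have hβ0 : 0 ≤ β := norm_nonneg _
  have h2W : ∀ x, 0 ≤ ((2 : ℝ) • W) x := fun x => by simpa using hW x
  have hR0 : ∀ s, 0 ≤ s → ∀ x, 0 ≤ R s 1 x := fun s hs x =>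
    G.opExp_schr_nonneg hD _ hs (fun _ => by simp) x
  have hRβ : ∀ s, 0 ≤ s → s ≤ T → ∀ x, R s 1 x ≤ β := fun s hs hsT x =>
    (G.opExp_schr_one_mono hD h2W hs hsT x).trans
      ((le_abs_self _).trans ((R T 1).norm_coe_le_norm x))
  have hcont : Continuous fun s => ‖P s W‖ := (continuous_opExp_apply _ W).norm
  have hint : 0 ≤ ∫ s in (0 : ℝ)..T, ‖P s W‖ :=
    intervalIntegral.integral_nonneg hT fun s _ => norm_nonneg _
  refine (BoundedContinuousFunction.norm_le (by positivity)).2 fun x => ?_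
  rw [Real.norm_eq_abs, abs_of_nonneg (hR0 T hT x)]
  -- Duhamel interpolation: `P_s R_{T-s} 1` runs from `R_T 1` to `P_T 1 = 1`. The Laplacians cancel
  -- in its derivative, leaving `-P_s(2W R_{T-s} 1) ≥ -2β‖P_s W‖`.
  have hmono := le_of_hasDerivAt_nonneg (a := 0) (b := T) hT
    (f := fun s => P s (R (T - s) 1) x + 2 * β * ∫ r in (0 : ℝ)..s, ‖P r W‖)
    (f' := fun s => -P s (((2 : ℝ) • W) * R (T - s) 1) x + 2 * β * ‖P s W‖)
    (fun s => ?_) (fun s hs hsT => ?_)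
  · simpa [hP, opExp_zero, opExp_lapL_one, hR] using hmono
  · refine HasDerivAt.add ?_ ((hcont.integral_hasStrictDerivAt 0 s).hasDerivAt.const_mul _)
    have := hasDerivAt_eval ((hasDerivAt_opExp (G.lapL hD) s).clm_apply
      (hasDerivAt_opExp_sub_apply (G.schr hD ((2 : ℝ) • W)) 1 T s)) x
    have e : (opExp (G.lapL hD) s * G.lapL hD) (R (T - s) 1) +
        opExp (G.lapL hD) s (-G.schr hD ((2 : ℝ) • W) (R (T - s) 1)) =
        -P s (((2 : ℝ) • W) * R (T - s) 1) := by
      have e0 : G.lapL hD (R (T - s) 1) + -G.schr hD ((2 : ℝ) • W) (R (T - s) 1) =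
          -(((2 : ℝ) • W) * R (T - s) 1) := by
        ext y; simp [schr, mul_assoc]
      rw [mul_apply_eq_comp, ← map_add, e0, map_neg]
    rw [e] at this
    exact this
  · have hs' : 0 ≤ T - s := sub_nonneg.2 hsT
    have h1 : P s (((2 : ℝ) • W) * R (T - s) 1) x ≤ P s ((2 * β) • W) x := by
      have := G.opExp_schr_mono hD 0 hs (g := ((2 : ℝ) • W) * R (T - s) 1) (h := (2 * β) • W)
        (fun y => by
          have := mul_le_mul_of_nonneg_left (hRβ (T - s) hs' (by linarith) y) (hW y)
          simp only [BoundedContinuousFunction.coe_mul, Pi.mul_apply,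
            BoundedContinuousFunction.coe_smul, smul_eq_mul]
          linarith) x
      rwa [schr_zero] at this
    rw [map_smul, BoundedContinuousFunction.smul_apply, smul_eq_mul] at h1
    have h2 : P s W x ≤ ‖P s W‖ := (le_abs_self _).trans ((P s W).norm_coe_le_norm x)
    have h3 := mul_le_mul_of_nonneg_left h2 (by positivity : 0 ≤ 2 * β)
    linarith

lemma opExp_schr_pow_le {v : V →ᵇ ℝ} {T : ℝ} (hT : 0 ≤ T) (n : ℕ) (x : V) :
    opExp (G.schr hD v) (n * T) 1 x ≤ ‖opExp (G.schr hD v) T 1‖ ^ n := by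
  induction n generalizing x with
  | zero => simp
  | succ n ih =>
    have e : ((n + 1 : ℕ) : ℝ) * T = T + n * T := by push_cast; ring
    set R := opExp (G.schr hD v) with hR
    have h0 : ∀ y, |R (n * T) 1 y| ≤ ‖R T 1‖ ^ n := fun y => by
      rw [abs_of_nonneg (G.opExp_schr_nonneg hD v (by positivity) (fun _ => by simp) y)]
      exact ih y
    rw [e, hR, opExp_add, mul_apply_eq_comp, pow_succ]
    refine (le_abs_self _).trans ((G.abs_opExp_schr_le hD v hT h0 x).trans ?_)
    exact mul_le_mul_of_nonneg_left ((le_abs_self _).trans ((R T 1).norm_coe_le_norm x))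
      (by positivity)

/-- Exponential decay of the Feynman-Kac semigroup with potential `2W - 2K`, for `W` with small
Kato constant. -/
lemma opExp_schr_decay {K T : ℝ} (hK : 0 < K) (hT : 0 < T) {W : V →ᵇ ℝ} (hW : ∀ x, 0 ≤ W x)
    (hk : ∫ s in (0 : ℝ)..T, ‖opExp (G.lapL hD) s W‖ ≤ 1 / 4 * (1 - Real.exp (-(K * T / 2))))
    {t : ℝ} (ht : 0 ≤ t) (x : V) :
    opExp (G.schr hD ((2 : ℝ) • W - (2 * K) • 1)) t 1 x ≤ 2 * Real.exp (-(K * t)) := by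
  have hβ := G.norm_opExp_schr_one_le hD hW hT.le
  have hsplit : G.schr hD ((2 : ℝ) • W - (2 * K) • 1) =
      G.schr hD ((2 : ℝ) • W) + (-(2 * K)) • 1 := by
    ext h y
    simp [schr]
    ring
  rw [hsplit, opExp_add_smul_one, smul_apply,
    BoundedContinuousFunction.smul_apply, smul_eq_mul]
  set R := opExp (G.schr hD ((2 : ℝ) • W))
  set β := ‖R T 1‖
  have hβ0 : 0 ≤ β := norm_nonneg _
  -- The Kato bound turns Khas'minskii's inequality into `β ≤ 1 + β(1 - e^{-KT/2})/2`; since `β` is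
  -- finite, the last term can be absorbed.
  have h1 : β * (1 + Real.exp (-(K * T / 2))) ≤ 2 := by
    nlinarith [mul_le_mul_of_nonneg_left hk hβ0]
  have hE := Real.exp_pos (-(K * T / 2))
  have hβ2 : β ≤ 2 := by nlinarith
  -- With `E = e^{KT/2} ≥ 1`, the previous bound reads `β ≤ 2E/(E+1) ≤ E`.
  have hβe : β ≤ Real.exp (K * T / 2) := by
    have h2 : Real.exp (K * T / 2) * Real.exp (-(K * T / 2)) = 1 := by
      rw [← Real.exp_add]; simp
    have h3 : 1 ≤ Real.exp (K * T / 2) := Real.one_le_exp (by positivity)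
    nlinarith
  set n := ⌊t / T⌋₊
  have hn1 : n * T ≤ t := (le_div_iff₀ hT).1 (Nat.floor_le (by positivity))
  have hn2 : t ≤ (n + 1 : ℕ) * T := by
    push_cast
    exact (div_le_iff₀ hT).1 (Nat.lt_floor_add_one (t / T)).le
  -- Of the `n + 1` periods covering `[0,t]`, one is paid by `β ≤ 2` and `n` by `β ≤ e^{KT/2}`. The
  -- final weakening of the exponent from `KnT/2` to `Kt` is affordable against `e^{-2Kt}`.
  have hRt : R t 1 x ≤ 2 * Real.exp (K * t) := by
    calc R t 1 x ≤ R ((n + 1 : ℕ) * T) 1 x :=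
          G.opExp_schr_one_mono hD (fun y => by simpa using hW y) ht hn2 x
      _ ≤ β ^ (n + 1) := G.opExp_schr_pow_le hD hT.le (n + 1) x
      _ = β * β ^ n := pow_succ' _ _
      _ ≤ 2 * Real.exp (K * T / 2) ^ n := by gcongr
      _ = 2 * Real.exp (K * (n * T) / 2) := by
          rw [← Real.exp_nat_mul]; congr 2; ring
      _ ≤ 2 * Real.exp (K * t) := by
          gcongr
          have := mul_le_mul_of_nonneg_left hn1 hK.le
          have := mul_nonneg hK.le ht
          linarith
  calc Real.exp (-(2 * K) * t) * R t 1 x ≤ Real.exp (-(2 * K) * t) * (2 * Real.exp (K * t)) := by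
        gcongr
    _ = 2 * (Real.exp (-(2 * K) * t) * Real.exp (K * t)) := by ring
    _ = _ := by rw [← Real.exp_add]; congr 2; ring

/-- A weight with small Kato constant can be truncated to a bounded one, with small Kato integral. -/
lemma integral_norm_le_kato {T : ℝ} (hT : 0 ≤ T) {w : V → ℝ} {W : V →ᵇ ℝ} {n : ℕ}
    (hWn : ∀ x, W x = min (n : ℝ) (w x)) :
    ENNReal.ofReal (∫ s in (0 : ℝ)..T, ‖opExp (G.lapL hD) s W‖) ≤ G.kato T w := by
  have hcont : Continuous fun s => ‖opExp (G.lapL hD) s W‖ := (continuous_opExp_apply _ W).norm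
  have e : (fun x => min (n : ℝ) (w x)) = W := funext fun x => (hWn x).symm
  rw [intervalIntegral.integral_of_le hT, MeasureTheory.ofReal_integral_eq_lintegral_ofReal
    (hcont.integrableOn_Ioc) (Filter.Eventually.of_forall fun _ => norm_nonneg _)]
  refine le_trans (MeasureTheory.lintegral_mono fun s => ?_) (le_iSup (fun n : ℕ =>
    ∫⁻ t in Set.Ioc 0 T, supNorm (G.heat t (fun x => min (n : ℝ) (w x)))) n)
  simp only [e, ← funext (G.opExp_lapL_apply hD s W)]
  exact ofReal_norm_le_supNorm _

end MWGraph

/-! ### Time integrals of functionals along a semigroup -/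

section Duhamel

variable {F : Type*} [NormedAddCommGroup F] [NormedSpace ℝ F]

/-- The functional `g ↦ ∫₀ᵗ Λ(e^{sA} g) ds`, obtained by exponentiating `(g, r) ↦ (A g, Λ g)`. -/
noncomputable def duhamel (A : F →L[ℝ] F) (Λ : F →L[ℝ] ℝ) (t : ℝ) : F →L[ℝ] ℝ :=
  ContinuousLinearMap.snd ℝ F ℝ ∘L
    opExp ((A ∘L ContinuousLinearMap.fst ℝ F ℝ).prod (Λ ∘L ContinuousLinearMap.fst ℝ F ℝ)) t ∘L
    ContinuousLinearMap.inl ℝ F ℝ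

/-- The scalar component lags one power of `A` behind; this is why `Λ(A^n g)` carries the
coefficient `t^(n+1)/(n+1)!` of an integrated exponential. -/
lemma prod_fst_pow_succ_apply (A : F →L[ℝ] F) (Λ : F →L[ℝ] ℝ) (n : ℕ) (p : F × ℝ) :
    (((A ∘L ContinuousLinearMap.fst ℝ F ℝ).prod (Λ ∘L ContinuousLinearMap.fst ℝ F ℝ)) ^ (n + 1)) p =
      ((A ^ (n + 1)) p.1, Λ ((A ^ n) p.1)) := by
  induction n with
  | zero => simp
  | succ n ih =>
    rw [pow_succ', mul_apply_eq_comp, ih, pow_succ' A (n + 1), mul_apply_eq_comp]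
    rfl

variable [CompleteSpace F]

lemma hasSum_duhamel (A : F →L[ℝ] F) (Λ : F →L[ℝ] ℝ) (t : ℝ) (g : F) :
    HasSum (fun n : ℕ => t ^ (n + 1) / (n + 1)! * Λ ((A ^ n) g)) (duhamel A Λ t g) := by
  have h := (hasSum_opExp_apply
    ((A ∘L ContinuousLinearMap.fst ℝ F ℝ).prod (Λ ∘L ContinuousLinearMap.fst ℝ F ℝ)) t
    (g, (0 : ℝ))).mapL (ContinuousLinearMap.snd ℝ F ℝ)
  have h' := (hasSum_nat_add_iff' 1).2 h
  simp only [prod_fst_pow_succ_apply, map_smul, ContinuousLinearMap.coe_snd', smul_eq_mul] at h'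
  simpa [duhamel] using h'

lemma opExp_prod_fst_fst (A : F →L[ℝ] F) (Λ : F →L[ℝ] ℝ) (t : ℝ) (g : F) :
    (opExp ((A ∘L ContinuousLinearMap.fst ℝ F ℝ).prod (Λ ∘L ContinuousLinearMap.fst ℝ F ℝ)) t
      (g, (0 : ℝ))).1 = opExp A t g := by
  have h := (hasSum_opExp_apply
    ((A ∘L ContinuousLinearMap.fst ℝ F ℝ).prod (Λ ∘L ContinuousLinearMap.fst ℝ F ℝ)) t
    (g, (0 : ℝ))).mapL (ContinuousLinearMap.fst ℝ F ℝ)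
  refine h.unique ?_
  convert hasSum_opExp_apply A t g using 2 with n
  cases n with
  | zero => simp
  | succ n => rw [prod_fst_pow_succ_apply]; simp

lemma hasDerivAt_duhamel (A : F →L[ℝ] F) (Λ : F →L[ℝ] ℝ) (g : F) (t : ℝ) :
    HasDerivAt (fun s => duhamel A Λ s g) (Λ (opExp A t g)) t := by
  have h := (ContinuousLinearMap.snd ℝ F ℝ).hasFDerivAt.comp_hasDerivAt t
    (hasDerivAt_opExp_apply
      ((A ∘L ContinuousLinearMap.fst ℝ F ℝ).prod (Λ ∘L ContinuousLinearMap.fst ℝ F ℝ)) (g, 0) t)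
  rw [← opExp_prod_fst_fst A Λ]
  exact h

end Duhamel

/-! ### Duality between `P_t f - f` and gradients of `P_s g` -/

namespace MWGraph

section Pairing

variable {V : Type*} (G : MWGraph V)

lemma abs_Gam_le (f h : V → ℝ) (x : V) :
    |G.Gam f h x| ≤ √(G.Gam f f x) * √(G.Gam h h x) := by
  rw [← Real.sqrt_mul (G.Gam_self_nonneg f x)]
  refine Real.abs_le_sqrt ?_
  have h0 := Finset.sum_sq_le_sum_mul_sum_of_sq_le_mul (G.nbrs x)
    (f := fun y => G.q x y * (f y - f x) ^ 2) (g := fun y => G.q x y * (h y - h x) ^ 2)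
    (r := fun y => G.q x y * ((f y - f x) * (h y - h x)))
    (fun y _ => mul_nonneg (G.q_nonneg x y) (sq_nonneg _))
    (fun y _ => mul_nonneg (G.q_nonneg x y) (sq_nonneg _)) (fun y _ => le_of_eq (by ring))
  rw [Gam_eq_sum, Gam_self, Gam_self]
  linarith

lemma Gam_self_le {D : ℝ} (hD : ∀ x, G.deg x ≤ D) {h : V → ℝ} {C : ℝ} (hC : ∀ x, |h x| ≤ C)
    (x : V) : G.Gam h h x ≤ 2 * D * C ^ 2 := by
  have h1 : ∑ y ∈ G.nbrs x, G.q x y * (h y - h x) ^ 2 ≤ ∑ y ∈ G.nbrs x, G.q x y * (2 * C) ^ 2 := by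
    refine Finset.sum_le_sum fun y _ => mul_le_mul_of_nonneg_left ?_ (G.q_nonneg x y)
    rw [← sq_abs]
    exact pow_le_pow_left₀ (abs_nonneg _) (by linarith [abs_sub (h y) (h x), hC x, hC y]) 2
  rw [← Finset.sum_mul] at h1
  have h2 := mul_le_mul_of_nonneg_right (hD x) (sq_nonneg (2 * C))
  rw [deg] at h2
  rw [Gam_self]
  linarith

/-- A crude bound used to make `energyL` continuous; its dependence on `D` does not reach the final
constant. -/
lemma sqrt_Gam_le {D : ℝ} (hD : ∀ x, G.deg x ≤ D) {h : V → ℝ} {C : ℝ} (hC : ∀ x, |h x| ≤ C)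
    (x : V) : √(G.Gam h h x) ≤ √(2 * D) * C := by
  have hC0 : 0 ≤ C := (abs_nonneg _).trans (hC x)
  have hD0 : 0 ≤ 2 * D := by linarith [G.deg_nonneg x, hD x]
  rw [← Real.sqrt_sq hC0, ← Real.sqrt_mul hD0]
  exact Real.sqrt_le_sqrt (G.Gam_self_le hD hC x)

lemma abs_m_mul_Gam_le {f h : V → ℝ} {B : ℝ} {x : V} (hB : √(G.Gam h h x) ≤ B) :
    |G.m x * G.Gam f h x| ≤ G.m x * √(G.Gam f f x) * B := by
  rw [abs_mul, abs_of_pos (G.m_pos x), mul_assoc]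
  refine mul_le_mul_of_nonneg_left ((G.abs_Gam_le f h x).trans ?_) (G.m_pos x).le
  exact mul_le_mul_of_nonneg_left hB (Real.sqrt_nonneg _)

lemma summable_m_mul_Gam {f h : V → ℝ} (hf : Summable fun x => G.m x * √(G.Gam f f x)) {B : ℝ}
    (hB : ∀ x, √(G.Gam h h x) ≤ B) : Summable fun x => G.m x * G.Gam f h x :=
  Summable.of_norm_bounded (f := fun x => G.m x * G.Gam f h x) (hf.mul_right B)
    fun x => G.abs_m_mul_Gam_le (hB x)

lemma abs_tsum_m_mul_Gam_le {f h : V → ℝ} (hf : Summable fun x => G.m x * √(G.Gam f f x)) {B : ℝ}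
    (hB : ∀ x, √(G.Gam h h x) ≤ B) :
    |∑' x, G.m x * G.Gam f h x| ≤ (∑' x, G.m x * √(G.Gam f f x)) * B := by
  rw [← tsum_mul_right]
  exact tsum_of_norm_bounded (f := fun x => G.m x * G.Gam f h x) (hf.mul_right B).hasSum fun x => G.abs_m_mul_Gam_le (hB x)

lemma q_eq_zero {x y : V} (h : y ∉ G.nbrs x) : G.q x y = 0 := by
  rw [mem_nbrs, not_lt] at h
  rw [q, le_antisymm h (G.w_nonneg x y), zero_div]

lemma w_eq_zero {x y : V} (h : y ∉ G.nbrs x) : G.w x y = 0 := by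
  rw [mem_nbrs, not_lt] at h
  exact le_antisymm h (G.w_nonneg x y)

lemma m_mul_q (x y : V) : G.m x * G.q x y = G.w x y := by
  rw [q, mul_div_cancel₀ _ (G.m_pos x).ne']

lemma m_mul_lap (f : V → ℝ) (z : V) :
    G.m z * G.lap f z = ∑ y ∈ G.nbrs z, G.w z y * (f y - f z) := by
  rw [lap, Finset.mul_sum]
  exact Finset.sum_congr rfl fun y _ => by rw [← mul_assoc, m_mul_q]

end Pairing

variable {V : Type*} [TopologicalSpace V] (G : MWGraph V)
variable {D : ℝ} (hD : ∀ x, G.deg x ≤ D)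

/-- The functional `h ↦ -∑_x m(x) Γ(f,h)(x)` on `ℓ^∞(V)`, for `f` with integrable gradient. -/
noncomputable def energyL {f : V → ℝ} (hf : Summable fun x => G.m x * √(G.Gam f f x)) :
    (V →ᵇ ℝ) →L[ℝ] ℝ :=
  LinearMap.mkContinuous
    { toFun := fun h => -∑' x, G.m x * G.Gam f h x
      map_add' := fun g h => by
        have hg := G.summable_m_mul_Gam hf (G.sqrt_Gam_le hD g.norm_coe_le_norm)
        have hh := G.summable_m_mul_Gam hf (G.sqrt_Gam_le hD h.norm_coe_le_norm)
        rw [← neg_add, ← hg.tsum_add hh]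
        congr 2
        ext x
        simp only [Gam_eq_sum, BoundedContinuousFunction.coe_add, Pi.add_apply]
        rw [← mul_add, ← mul_add, ← Finset.sum_add_distrib]
        congr 2
        exact Finset.sum_congr rfl fun y _ => by ring
      map_smul' := fun c h => by
        rw [RingHom.id_apply, smul_eq_mul, mul_neg, ← tsum_mul_left]
        congr 2
        ext x
        simp only [Gam_eq_sum, BoundedContinuousFunction.coe_smul, smul_eq_mul, Finset.mul_sum]
        exact Finset.sum_congr rfl fun y _ => by ring }
    ((∑' x, G.m x * √(G.Gam f f x)) * √(2 * D)) fun h => by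
      have := G.abs_tsum_m_mul_Gam_le hf (G.sqrt_Gam_le hD h.norm_coe_le_norm)
      rw [mul_assoc, LinearMap.coe_mk, AddHom.coe_mk, Real.norm_eq_abs, abs_neg]
      exact this

lemma energyL_apply {f : V → ℝ} (hf : Summable fun x => G.m x * √(G.Gam f f x)) (h : V →ᵇ ℝ) :
    G.energyL hD hf h = -∑' x, G.m x * G.Gam f h x := rfl

variable [DiscreteTopology V]

open Classical in
/-- The indicator function of a vertex. -/
noncomputable def vertexInd (z : V) : V →ᵇ ℝ :=
  BoundedContinuousFunction.ofNormedAddCommGroupDiscrete (fun x => if x = z then 1 else 0) 1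
    fun x => by split_ifs <;> simp

open Classical in
lemma vertexInd_apply (z x : V) : vertexInd z x = if x = z then 1 else 0 := rfl

lemma sum_q_mul_vertexInd (x z : V) (a : V → ℝ) :
    ∑ y ∈ G.nbrs x, G.q x y * a y * vertexInd z y = G.q x z * a z := by
  classical
  by_cases hz : z ∈ G.nbrs x
  · simp [vertexInd_apply, hz]
  · rw [G.q_eq_zero hz, zero_mul]
    refine Finset.sum_eq_zero fun y hy => ?_
    have : y ≠ z := fun e => hz (e ▸ hy)
    simp [vertexInd_apply, this]

lemma energyL_vertexInd {f : V → ℝ} (hf : Summable fun x => G.m x * √(G.Gam f f x)) (z : V) :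
    G.energyL hD hf (vertexInd z) = G.m z * G.lap f z := by
  classical
  -- Summation by parts at one vertex: the neighbours of `z` contribute `h1`, the vertex itself
  -- `h2`, each with the factor `1/2` from `Γ`.
  have h1 : HasSum (fun x => G.w z x * (f z - f x)) (-(G.m z * G.lap f z)) := by
    have : -(G.m z * G.lap f z) = ∑ x ∈ G.nbrs z, G.w z x * (f z - f x) := by
      rw [m_mul_lap, ← Finset.sum_neg_distrib]
      exact Finset.sum_congr rfl fun y _ => by ring
    rw [this]
    exact hasSum_sum_of_ne_finset_zero fun x hx => by rw [G.w_eq_zero hx, zero_mul]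
  have h2 : HasSum (fun x => if x = z then G.m z * G.lap f z else 0) (G.m z * G.lap f z) :=
    hasSum_ite_eq z _
  have h3 : HasSum (fun x => G.m x * G.Gam f (vertexInd z) x) (-(G.m z * G.lap f z)) := by
    have e0 : -(G.m z * G.lap f z) = 1 / 2 * (-(G.m z * G.lap f z) - G.m z * G.lap f z) := by ring
    rw [e0]
    refine ((h1.sub h2).mul_left (1 / 2)).congr_fun fun x => ?_
    have e1 : G.Gam f (vertexInd z) x =
        1 / 2 * (G.q x z * (f z - f x) - vertexInd z x * G.lap f x) := by
      rw [Gam_eq_sum, ← G.sum_q_mul_vertexInd x z (fun y => f y - f x), lap,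
        Finset.mul_sum _ _ (vertexInd z x), ← Finset.sum_sub_distrib]
      congr 1
      exact Finset.sum_congr rfl fun y _ => by ring
    rw [e1, G.w_symm z x, ← G.m_mul_q x z, vertexInd_apply]
    split_ifs with hx
    · subst hx; ring
    · ring
  rw [energyL_apply, h3.tsum_eq, neg_neg]

/-- Symmetry of `w` lets the normalised indicators `vertexInd y / m(y)` appear, on which the energy
functional reproduces values of iterated Laplacians of `f`. -/
lemma lapL_vertexInd (z : V) :
    G.lapL hD (vertexInd z) =
      ∑ y ∈ G.nbrs z, G.w z y • ((G.m y)⁻¹ • vertexInd y - (G.m z)⁻¹ • vertexInd z) := by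
  classical
  ext x
  have e1 : G.lap (vertexInd z) x = G.q x z - vertexInd z x * G.deg x := by
    have := G.sum_q_mul_vertexInd x z (fun _ => 1)
    rw [mul_one] at this
    rw [← this, lap, deg, Finset.mul_sum, ← Finset.sum_sub_distrib]
    exact Finset.sum_congr rfl fun y _ => by ring
  have e2 : G.q x z = ∑ y ∈ G.nbrs z, G.w z y * ((G.m y)⁻¹ * vertexInd y x) := by
    by_cases hx : x ∈ G.nbrs z
    · simp [vertexInd_apply, hx, q, G.w_symm x z, div_eq_mul_inv]
    · rw [q, G.w_symm, G.w_eq_zero hx, zero_div]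
      refine (Finset.sum_eq_zero fun y hy => ?_).symm
      have : x ≠ y := fun e => hx (e ▸ hy)
      simp [vertexInd_apply, this]
  have e3 : vertexInd z x * G.deg x = ∑ y ∈ G.nbrs z, G.w z y * ((G.m z)⁻¹ * vertexInd z x) := by
    rw [vertexInd_apply]
    split_ifs with hx
    · subst hx
      simp [deg, q, div_eq_mul_inv]
    · simp
  rw [lapL_apply, e1, e2, e3, ← Finset.sum_sub_distrib, BoundedContinuousFunction.sum_apply]
  exact Finset.sum_congr rfl fun y _ => by simp; ring

/-- Self-adjointness of `Δ`, reduced to finite sums: the innermost `Δ` is expanded into indicators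
of neighbours, to which the induction hypothesis applies. -/
lemma energyL_lapL_pow_vertexInd {f : V → ℝ} (hf : Summable fun x => G.m x * √(G.Gam f f x))
    (n : ℕ) (z : V) :
    G.energyL hD hf ((G.lapL hD ^ n) (vertexInd z)) = G.m z * (G.lap^[n + 1] f) z := by
  induction n generalizing z with
  | zero => simpa using G.energyL_vertexInd hD hf z
  | succ n ih =>
    rw [pow_succ, mul_apply_eq_comp, lapL_vertexInd, Function.iterate_succ_apply', m_mul_lap]
    simp only [map_sum, map_smul, map_sub, ih, smul_eq_mul]
    refine Finset.sum_congr rfl fun y _ => ?_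
    rw [inv_mul_cancel_left₀ (G.m_pos y).ne', inv_mul_cancel_left₀ (G.m_pos z).ne']

/-- As `f` may be unbounded, `P_t f` is not given by the semigroup on `ℓ^∞`. The two series are
compared term by term, which moves the semigroup onto the indicator. -/
lemma heat_sub_eq_duhamel {f : V → ℝ} (hf : Summable fun x => G.m x * √(G.Gam f f x)) (t : ℝ)
    (z : V) :
    G.m z * (G.heat t f z - f z) = duhamel (G.lapL hD) (G.energyL hD hf) t (vertexInd z) := by
  have hm := (G.m_pos z).ne'
  have h := (hasSum_duhamel (G.lapL hD) (G.energyL hD hf) t (vertexInd z)).mul_left (G.m z)⁻¹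
  simp only [energyL_lapL_pow_vertexInd] at h
  have e : ∀ n : ℕ, (G.m z)⁻¹ * (t ^ (n + 1) / (n + 1)! * (G.m z * (G.lap^[n + 1] f) z)) =
      t ^ (n + 1) / (n + 1)! * (G.lap^[n + 1] f) z := fun n => by field_simp
  simp only [e] at h
  have h' := (hasSum_nat_add_iff (f := fun n : ℕ => t ^ n / n ! * (G.lap^[n] f) z) 1).1 h
  rw [heat, h'.tsum_eq]
  simp
  field_simp

lemma duhamel_energyL_le {f : V → ℝ} (hf : Summable fun x => G.m x * √(G.Gam f f x))
    (hgrad : ∀ (g : V →ᵇ ℝ) (s : ℝ), 0 ≤ s → ∀ x,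
      s * G.Gam (opExp (G.lapL hD) s g) (opExp (G.lapL hD) s g) x ≤ 2 * ‖g‖ ^ 2)
    {g : V →ᵇ ℝ} (hg : ‖g‖ ≤ 1) {t : ℝ} (ht : 0 ≤ t) :
    duhamel (G.lapL hD) (G.energyL hD hf) t g ≤
      2 * √2 * √t * ∑' x, G.m x * √(G.Gam f f x) := by
  set N := ∑' x, G.m x * √(G.Gam f f x)
  set θ := fun s => duhamel (G.lapL hD) (G.energyL hD hf) s g with hθ
  have hθd : ∀ s, HasDerivAt θ (G.energyL hD hf (opExp (G.lapL hD) s g)) s :=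
    hasDerivAt_duhamel _ _ g
  have hΛ : ∀ s, 0 < s → G.energyL hD hf (opExp (G.lapL hD) s g) ≤ N * (√2 / √s) := by
    intro s hs
    refine (le_abs_self _).trans ?_
    rw [energyL_apply, abs_neg]
    refine G.abs_tsum_m_mul_Gam_le hf fun x => ?_
    rw [← Real.sqrt_div zero_le_two]
    refine Real.sqrt_le_sqrt ((le_div_iff₀ hs).2 ?_)
    nlinarith [hgrad g s hs.le x, norm_nonneg g]
  have hd : ∀ s, 0 < s →
      HasDerivAt (fun s => 2 * √2 * N * √s - θ s) (2 * √2 * N * (1 / (2 * √s)) -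
        G.energyL hD hf (opExp (G.lapL hD) s g)) s := fun s hs =>
    ((Real.hasDerivAt_sqrt hs.ne').const_mul _).sub (hθd s)
  -- `2√2 N√s` is the primitive of `N√(2/s)`. It is not differentiable at `0`, so derivatives are
  -- used only in the interior.
  have hmono : MonotoneOn (fun s => 2 * √2 * N * √s - θ s) (Set.Icc 0 t) := by
    refine monotoneOn_of_deriv_nonneg (convex_Icc 0 t) ?_ ?_ ?_
    · have hc : Continuous θ := continuous_iff_continuousAt.2 fun s => (hθd s).continuousAt
      fun_prop
    · intro s hs
      rw [interior_Icc] at hs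
      exact (hd s hs.1).differentiableAt.differentiableWithinAt
    · intro s hs
      rw [interior_Icc] at hs
      rw [(hd s hs.1).deriv, sub_nonneg]
      refine (hΛ s hs.1).trans_eq ?_
      have := (Real.sqrt_pos.2 hs.1).ne'
      field_simp
  have h := hmono (Set.left_mem_Icc.2 ht) (Set.right_mem_Icc.2 ht) ht
  have h0 : θ 0 = 0 := by simp [hθ, duhamel]
  simp only [Real.sqrt_zero, mul_zero, h0, sub_zero] at h
  linarith

lemma norm_sum_smul_vertexInd_le (S : Finset V) {ε : V → ℝ} (hε : ∀ z, |ε z| ≤ 1) :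
    ‖∑ z ∈ S, ε z • vertexInd z‖ ≤ 1 := by
  classical
  refine (BoundedContinuousFunction.norm_le zero_le_one).2 fun x => ?_
  rw [BoundedContinuousFunction.sum_apply]
  simp only [BoundedContinuousFunction.coe_smul, vertexInd_apply, smul_eq_mul, mul_ite, mul_one,
    mul_zero, Finset.sum_ite_eq]
  split_ifs
  · exact hε x
  · simp

lemma norm1_sub_heat_le {f : V → ℝ} (hf : Summable fun x => G.m x * √(G.Gam f f x))
    (hgrad : ∀ (g : V →ᵇ ℝ) (s : ℝ), 0 ≤ s → ∀ x,
      s * G.Gam (opExp (G.lapL hD) s g) (opExp (G.lapL hD) s g) x ≤ 2 * ‖g‖ ^ 2)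
    {t : ℝ} (ht : 0 ≤ t) :
    G.norm1 (fun x => f x - G.heat t f x) ≤
      ENNReal.ofReal (2 * √2 * √t * ∑' x, G.m x * √(G.Gam f f x)) := by
  rw [norm1, ENNReal.tsum_eq_iSup_sum]
  refine iSup_le fun S => ?_
  rw [← ENNReal.ofReal_sum_of_nonneg fun x _ => mul_nonneg (G.m_pos x).le (abs_nonneg _)]
  refine ENNReal.ofReal_le_ofReal ?_
  -- The signs turn the partial sum of `m|P_t f - f|` over `S` into the pairing with one test
  -- function of norm at most `1`.
  set ε : V → ℝ := fun z => SignType.sign (G.heat t f z - f z) with hε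
  have hε1 : ∀ z, |ε z| ≤ 1 := fun z => by
    simp only [hε]
    rcases SignType.sign (G.heat t f z - f z) with _ | _ | _ <;> simp
  refine le_trans (le_of_eq ?_)
    (G.duhamel_energyL_le hD hf hgrad (norm_sum_smul_vertexInd_le S hε1) ht)
  rw [map_sum]
  refine Finset.sum_congr rfl fun z _ => ?_
  rw [map_smul, ← heat_sub_eq_duhamel, abs_sub_comm, ← sign_mul_self, smul_eq_mul]
  ring

end MWGraph

/-! ### Truncation of the curvature and conclusion -/

theorem mainTheorem8 (K T : ℝ) (hK : 0 < K) (hT : 0 < T) :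
    ∃ c : ℝ, 0 < c ∧
      ∀ (V : Type*) [Countable V] (G : MWGraph V) (ρ : V → ℝ),
        G.BoundedDegree →
        G.CD ρ ⊤ →
        G.kato T (fun x => (ρ x - K)⁻) < ENNReal.ofReal (1 / 4 * (1 - Real.exp (-(K * T / 2)))) →
        ∀ (f : V → ℝ) (t : ℝ), 0 ≤ t →
          G.norm1 (fun x => f x - G.heat t f x) ≤
            ENNReal.ofReal (c * Real.sqrt t) * G.norm1 (fun x => Real.sqrt (G.Gam f f x)) := by
  refine ⟨2 * √2, by positivity, fun V _ G ρ hG hCD hkato f t ht => ?_⟩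
  let _ : TopologicalSpace V := ⊥
  have : DiscreteTopology V := ⟨rfl⟩
  by_cases htop : G.norm1 (fun x => √(G.Gam f f x)) = ∞
  -- At `t = 0` the right-hand side is `0 · ∞ = 0`, so the left must vanish exactly: the series
  -- reduces to its term `n = 0`.
  · rcases ht.eq_or_lt with rfl | ht
    · have h0 : ∀ x, G.heat 0 f x = f x := fun x => by
        rw [MWGraph.heat, tsum_eq_single 0 fun n hn => by simp [hn]]
        simp
      simp [h0, MWGraph.norm1]
    · rw [htop, ENNReal.mul_top (by simpa using ht)]
      exact le_top
  obtain ⟨D, hD, hD0⟩ : ∃ D, (∀ x, G.deg x ≤ D) ∧ 0 < D := by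
    obtain ⟨D, hD⟩ := hG
    exact ⟨max D 1, fun x => (hD ⟨x, rfl⟩).trans (le_max_left _ _), by positivity⟩
  have habs : ∀ x, G.m x * |√(G.Gam f f x)| = G.m x * √(G.Gam f f x) := fun x => by
    rw [abs_of_nonneg (Real.sqrt_nonneg _)]
  have hnn : ∀ x, 0 ≤ G.m x * √(G.Gam f f x) := fun x =>
    mul_nonneg (G.m_pos x).le (Real.sqrt_nonneg _)
  rw [MWGraph.norm1] at htop
  simp only [habs] at htop
  have hsum : Summable fun x => G.m x * √(G.Gam f f x) := by
    have := ENNReal.summable_toReal htop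
    simpa only [ENNReal.toReal_ofReal (hnn _)] using this
  -- Where the truncation at this level is active, `K - W = K - n ≤ -D`, and the bounded-degree
  -- curvature bound takes over; elsewhere `K - W ≤ ρ`.
  obtain ⟨n, hn⟩ := exists_nat_ge (K + D)
  set w : V → ℝ := fun x => (ρ x - K)⁻ with hw
  have hw0 : ∀ x, 0 ≤ w x := fun x => negPart_nonneg _
  have hW0 : ∀ x, 0 ≤ min (n : ℝ) (w x) := fun x => le_min n.cast_nonneg (hw0 x)
  set W : BoundedContinuousFunction V ℝ :=
    BoundedContinuousFunction.ofNormedAddCommGroupDiscrete (fun x => min (n : ℝ) (w x)) n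
      (fun x => by rw [Real.norm_eq_abs, abs_of_nonneg (hW0 x)]; exact min_le_left _ _) with hW
  have hCDW : ∀ (u : BoundedContinuousFunction V ℝ) x,
      (K - W x) * G.Gam u u x ≤ G.Gam2 u u x := by
    intro u x
    have h1 := hCD u ⟨‖u‖, u.norm_coe_le_norm⟩ x
    simp only [ENNReal.inv_top, ENNReal.toReal_zero, zero_mul, add_zero] at h1
    have h2 := G.neg_mul_Gam_le_Gam2 hD0 hD u x
    have hWx : W x = min (n : ℝ) (w x) := rfl
    have hwx : -(ρ x - K) ≤ w x := neg_le_negPart _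
    rw [hWx]
    rcases min_choice (n : ℝ) (w x) with h | h <;> rw [h]
    · exact (mul_le_mul_of_nonneg_right (by linarith) (G.Gam_self_nonneg u x)).trans h2
    · exact (mul_le_mul_of_nonneg_right (by linarith) (G.Gam_self_nonneg u x)).trans h1
  have hk : ∫ s in (0 : ℝ)..T, ‖opExp (G.lapL hD) s W‖ ≤
      1 / 4 * (1 - Real.exp (-(K * T / 2))) := by
    have h1 := (G.integral_norm_le_kato hD hT.le (W := W) (w := w) (n := n) fun x => rfl).trans_lt
      hkato
    exact ((ENNReal.ofReal_lt_ofReal_iff_of_nonneg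
      (intervalIntegral.integral_nonneg hT.le fun s _ => norm_nonneg _)).1 h1).le
  have hgrad := fun (g : BoundedContinuousFunction V ℝ) (s : ℝ) (hs : 0 ≤ s) (x : V) =>
    G.mul_Gam_heat_le hD hK hW0 hCDW
      (fun t ht x => G.opExp_schr_decay hD hK hT hW0 hk ht x) g hs x
  refine (G.norm1_sub_heat_le hD hsum hgrad ht).trans_eq ?_
  rw [ENNReal.ofReal_mul (by positivity), MWGraph.norm1]
  simp only [habs]
  rw [ENNReal.ofReal_tsum_of_nonneg hnn hsum]
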